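/- Let $K$ be a number field with ring of integers $\mathcal O_K$, let $F(x)\in\mathcal O_K[x]$ be a monic cubic polynomial, and let $E: y^2=F(x)$ be an elliptic curve over $K$. Let $v$ be a finite prime of $K$ lying above $2$, with completion $K_v$, and put $L_v:=K_v[x]/(F(x))$, with $\theta\in L_v$ the class of $x$ and $N:L_v^\times\to K_v^\times$ the norm. Write $[\alpha]$ for the class of $\alpha\in L_v^\times$ in $L_v^\times/(L_v^\times)^2$, and let $L_w$ run through the field factors of $L_v\simeq\prod_w L_w$, with normalized valuations $w$. Set $$M_{1,v}=\{[\alpha] : N(\alpha)\in (K_v^\times)^2,\ L_w(\sqrt{\alpha})/L_w \text{ is unramified for all } w\},$$ $$M_{2,v}=\{[\alpha] : N(\alpha)\in (K_v^\times)^2,\ w(\alpha)\in 2\mathbb Z \text{ for all } w\},$$ and let $\delta_{K_v}:E(K_v)/2E(K_v)\to L_v^\times/(L_v^\times)^2$ be the local Kummer map, given by $\delta_{K_v}(O)=[1]$, by $\delta_{K_v}(P)=[x(P)-\theta]$ if $y(P)\ne 0$, and by $\delta_{K_v}(P)=[x(P)-\theta+G(\theta)]$ with $G(x)=F(x)/(x-x(P))$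 if $y(P)=0$. The curve $E$ is called nice at $v$ if $M_{1,v}\subset \mathrm{im}(\delta_{K_v})\subset M_{2,v}$. Suppose that $|E(K_v)[2]|=1$. Then $L_v$ is a cubic field extension of $K_v$, and $E$ is nice at $v$. -/

import Mathlib

open Polynomial NumberField IsDedekindDomain

noncomputable section

/-! ### The elliptic curve `y² = f(x)` and the algebra `k[x]/(f)` -/

/-- The Weierstrass curve `y² = x³ + a₂ x² + a₄ x + a₆`, i.e. `y² = f(x)` for a monic cubic
polynomial `f = x³ + a₂ x² + a₄ x + a₆`. -/
def cubicCurve {R : Type*} [CommRing R] (f : R[X]) : WeierstrassCurve R where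
  a₁ := 0
  a₂ := f.coeff 2
  a₃ := 0
  a₄ := f.coeff 1
  a₆ := f.coeff 0

/-- The construction commutes with base change. -/
theorem cubicCurve_map {R S : Type*} [CommRing R] [CommRing S] (φ : R →+* S) (f : R[X]) :
    (cubicCurve f).map φ = cubicCurve (f.map φ) := by
  ext <;> simp [cubicCurve]

/-- An affine point `(x, y)` of the curve satisfies `y² = f(x)` if `f` is a monic cubic. -/
theorem cubicCurve_equation {k : Type*} [Field k] {f : k[X]} (hf : f.Monic)
    (hd : f.natDegree = 3) {x y : k} (h : (cubicCurve f).toAffine.Equation x y) :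
    f.eval x = y ^ 2 := by
  have h3 : f.coeff 3 = 1 := by rw [← hd]; exact hf
  rw [WeierstrassCurve.Affine.equation_iff] at h
  simp only [cubicCurve] at h
  rw [Polynomial.eval_eq_sum_range, hd]
  simp only [Finset.sum_range_succ, Finset.sum_range_zero, h3]
  linear_combination -h

/-- At a nonsingular point with `y = 0` the derivative of `f` does not vanish. -/
theorem cubicCurve_deriv {k : Type*} [Field k] {f : k[X]} (hf : f.Monic)
    (hd : f.natDegree = 3) {x : k} (h : (cubicCurve f).toAffine.Nonsingular x 0) :
    f.derivative.eval x ≠ 0 := by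
  have h3 : f.coeff 3 = 1 := by rw [← hd]; exact hf
  have hs : f = X ^ 3 + C (f.coeff 2) * X ^ 2 + C (f.coeff 1) * X + C (f.coeff 0) := by
    conv_lhs => rw [f.as_sum_range_C_mul_X_pow, hd]
    simp only [Finset.sum_range_succ, Finset.sum_range_zero, h3, map_one]
    ring
  intro h0
  rw [hs] at h0
  simp at h0
  rw [WeierstrassCurve.Affine.nonsingular_iff] at h
  rcases h.2 with h | h
  · apply h
    simp only [cubicCurve]
    linear_combination -h0
  · simp [cubicCurve] at h

/-- The étale algebra `k[x]/(f)`; the class of `x` is `AdjoinRoot.root f`. -/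
abbrev CubicAlgebra {k : Type*} [Field k] (f : k[X]) : Type _ := AdjoinRoot f

/-- The group `A / A²` for a commutative ring's unit group `A = Rˣ`. -/
abbrev UnitsModSquares (R : Type*) [CommRing R] : Type _ :=
  Rˣ ⧸ (powMonoidHom 2 : Rˣ →* Rˣ).range

/-- The class `[α]` of a unit modulo squares. -/
abbrev sqClass {R : Type*} [CommRing R] (α : Rˣ) : UnitsModSquares R :=
  QuotientGroup.mk α

/-! ### The Kummer map -/

/-- A polynomial whose class modulo `f` represents the Kummer class of the point `(x, y)` of
`y² = f(x)`: it is `x - X`, and for a `2`-torsion point (`y = 0`), where `x - X` is a zero divisor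
modulo `f`, it is `x - X + f(X)/(X - x)`. In the latter case, with `g = f(X)/(X - x)` and
`k[X]/(f) ≃ k × k[X]/(g)`, the components are `g(x)` and `x - X`, so that the norm is again a
square. -/
def kummerPoly {k : Type*} [Field k] (f : k[X]) (x y : k) : k[X] :=
  open Classical in
  if y = 0 then C x - X + f /ₘ (X - C x) else C x - X

/-- The polynomial `kummerPoly` defines a unit modulo `f`. -/
theorem isUnit_kummerPoly {k : Type*} [Field k] {f : k[X]} (hf : f.Monic)
    (hd : f.natDegree = 3) {x y : k} (h : (cubicCurve f).toAffine.Nonsingular x y) :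
    IsUnit (AdjoinRoot.mk f (kummerPoly f x y)) := by
  have hev := cubicCurve_equation hf hd h.1
  suffices hc : IsCoprime f (kummerPoly f x y) by
    obtain ⟨a, b, hab⟩ := hc
    refine IsUnit.of_mul_eq_one (AdjoinRoot.mk f b) ?_
    rw [← map_mul, ← map_one (AdjoinRoot.mk f), AdjoinRoot.mk_eq_mk]
    exact ⟨-a, by linear_combination hab⟩
  have key : ∀ p : k[X], p.eval x ≠ 0 → IsCoprime p (C x - X) := by
    intro p hp
    have h1 : IsCoprime (X - C x) p :=
      ((irreducible_X_sub_C x).coprime_iff_not_dvd).2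
        (by rwa [dvd_iff_isRoot])
    have h2 := h1.symm.neg_right
    rwa [neg_sub] at h2
  unfold kummerPoly
  split_ifs with hy
  · subst hy
    have hroot : f.IsRoot x := by rw [IsRoot, hev]; ring
    have hmul := mul_divByMonic_eq_iff_isRoot.2 hroot
    set g := f /ₘ (X - C x) with hg
    have hgx : g.eval x ≠ 0 := by
      have hder := cubicCurve_deriv hf hd h
      rw [← hmul] at hder
      simpa using hder
    have hcop := key g hgx
    rw [← hmul]
    refine IsCoprime.mul_left ?_ ?_
    · have h1 : IsCoprime (C x - X) g := hcop.symm
      have h2 : IsCoprime (C x - X) (C x - X + g) := by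
        simpa [add_comm] using h1.add_mul_left_right 1
      have h3 := h2.neg_left
      rwa [neg_sub] at h3
    · simpa using hcop.add_mul_left_right 1
  · exact key f (by rw [hev]; exact pow_ne_zero 2 hy)

/-- The Kummer map `δ` of `E : y² = f(x)` over `k`, as a map on `E(k)` (it factors through
`E(k)/2E(k)`, so it has the same image as the induced map on that quotient), with values in the
units of `k[x]/(f)` modulo squares: `δ(P)` is the class of `x(P) - θ`, where `θ` is the class of
`x`, suitably modified at points of order two; `δ(O) = 1`. -/
def kummerMap {k : Type*} [Field k] (f : k[X]) (hf : f.Monic) (hd : f.natDegree = 3) :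
    (cubicCurve f).toAffine.Point → UnitsModSquares (CubicAlgebra f)
  | .zero => 1
  | .some _ _ h => sqClass (isUnit_kummerPoly hf hd h).unit

/-! ### Local conditions and niceness

Here `O` is the ring of integers of the local field `k`. The primes of `k[x]/(f)` are indexed by its
maximal ideals `w`, whose residue fields are the factors `L_w` of
`k[x]/(f) ≃ L_{w₁} × ⋯ × L_{wₙ}`. -/

/-- The field factor of `k[x]/(f)` at `w`. -/
abbrev FactorField {k : Type*} [Field k] {f : k[X]} (w : MaximalSpectrum (CubicAlgebra f)) :
    Type _ :=
  CubicAlgebra f ⧸ w.asIdeal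

instance {k : Type*} [Field k] {f : k[X]} (w : MaximalSpectrum (CubicAlgebra f)) :
    Field (FactorField w) :=
  letI := w.isMaximal
  Ideal.Quotient.field w.asIdeal

/-- The component at `w` of an element of `k[x]/(f)`. -/
abbrev factorMap {k : Type*} [Field k] {f : k[X]} (w : MaximalSpectrum (CubicAlgebra f)) :
    CubicAlgebra f →+* FactorField w :=
  Ideal.Quotient.mk w.asIdeal

/-- `α ∈ M` has normalized valuation `n`, i.e. `α = u πⁿ` with `π` a uniformizer and `u` a unit of
the ring of integers of `M` (the integral closure of `O` in `M`, a discrete valuation ring). -/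
def HasNormalizedValuation (O : Type*) {M : Type*} [CommRing O] [Field M] [Algebra O M]
    (α : M) (n : ℤ) : Prop :=
  ∃ (π : integralClosure O M) (u : (integralClosure O M)ˣ),
    Irreducible π ∧ α = ((u : integralClosure O M) : M) * (π : M) ^ n

/-- The field extension `N/M` is unramified: the ring of integers of `N` is unramified over the
ring of integers of `M` (the integral closure of `O` in `M`). -/
def IsUnramifiedExtension (O M N : Type*) [CommRing O] [Field M] [Field N] [Algebra O M]
    [Algebra M N] : Prop :=
  Algebra.Unramified (integralClosure O M) (integralClosure (integralClosure O M) N)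

/-- `M(√α)/M` is unramified, where `M(√α)` is the splitting field of `X² - α` over `M`. -/
def SqrtExtensionUnramified (O : Type*) {M : Type*} [CommRing O] [Field M] [Algebra O M]
    (α : M) : Prop :=
  IsUnramifiedExtension O M (X ^ 2 - C α : M[X]).SplittingField

section Local

variable {k : Type*} [Field k] (O : ValuationSubring k) (f : k[X])

/-- `M₁`: classes `[α]` of units with square norm such that `k[x]/(f)` with `√α` adjoined is
unramified over `k[x]/(f)`, i.e. `L_w(√α)/L_w` is unramified for all `w`. -/
def localConditionOne : Set (UnitsModSquares (CubicAlgebra f)) :=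
  {c | ∃ α : (CubicAlgebra f)ˣ, c = sqClass α ∧
    IsSquare (Algebra.norm k (α : CubicAlgebra f)) ∧
    ∀ w : MaximalSpectrum (CubicAlgebra f),
      SqrtExtensionUnramified O (factorMap w (α : CubicAlgebra f))}

/-- `M₂`: classes `[α]` of units with square norm such that `w(α)` is even for all `w`. -/
def localConditionTwo : Set (UnitsModSquares (CubicAlgebra f)) :=
  {c | ∃ α : (CubicAlgebra f)ˣ, c = sqClass α ∧
    IsSquare (Algebra.norm k (α : CubicAlgebra f)) ∧
    ∀ w : MaximalSpectrum (CubicAlgebra f),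
      ∃ n : ℤ, Even n ∧ HasNormalizedValuation O (factorMap w (α : CubicAlgebra f)) n}

/-- The curve `y² = f(x)` over `k` is lower nice: `M₁ ⊆ im δ`. -/
def IsLowerNice (hf : f.Monic) (hd : f.natDegree = 3) : Prop :=
  localConditionOne O f ⊆ Set.range (kummerMap f hf hd)

/-- The curve `y² = f(x)` over `k` is upper nice: `im δ ⊆ M₂`. -/
def IsUpperNice (hf : f.Monic) (hd : f.natDegree = 3) : Prop :=
  Set.range (kummerMap f hf hd) ⊆ localConditionTwo O f

/-- The curve `y² = f(x)` over `k` is nice: both lower and upper nice. -/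
def IsNice (hf : f.Monic) (hd : f.natDegree = 3) : Prop :=
  IsLowerNice O f hf hd ∧ IsUpperNice O f hf hd

end Local

/-! ### Number fields -/

section Global

variable {K : Type*} [Field K] [NumberField K]

/-- The polynomial `F ∈ 𝓞_K[x]` viewed over the completion `K_v`. -/
abbrev localPoly (F : (𝓞 K)[X]) (v : HeightOneSpectrum (𝓞 K)) : (v.adicCompletion K)[X] :=
  F.map (algebraMap (𝓞 K) (v.adicCompletion K))

/-- The curve `E : y² = F(x)` over `K` is nice at the finite prime `v`, i.e. `E/K_v` is nice. -/
def IsNiceAt (F : (𝓞 K)[X]) (hF : F.Monic) (hd : F.natDegree = 3)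
    (v : HeightOneSpectrum (𝓞 K)) : Prop :=
  IsNice (v.adicCompletionIntegers K) (localPoly F v) (hF.map _)
    ((hF.natDegree_map _).trans hd)

/-- The finite prime `v` is even, i.e. lies above `2`. -/
def IsEvenPrime (v : HeightOneSpectrum (𝓞 K)) : Prop :=
  (2 : 𝓞 K) ∈ v.asIdeal

open Classical in
/-- The `2`-torsion subgroup `E(k)[2]` of the group of points of `E : y² = f(x)`. -/
abbrev twoTorsion {k : Type*} [Field k] (f : k[X]) :
    AddSubgroup (cubicCurve f).toAffine.Point :=
  (zsmulAddGroupHom (2 : ℤ)).ker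

end Global

end

/-!
Write `k = K_v`, `O` for its ring of integers and `f` for the cubic over `k`. A root of `f` in `k`
would be the abscissa of a point of order two, so `f` is irreducible and `L = k[x]/(f)` is a cubic
field. What matters from here on is only that `L/k` is a finite extension of odd degree.

*Upper niceness.* There are no points with `y = 0`, so `δ(P) = [x(P) - θ]` and
`N(x(P) - θ) = f(x(P)) = y(P)²`. If `e` and `m` denote the valuation in `L` of a uniformizer of `k`
and the valuation of the norm of a uniformizer of `L`, then `e m = [L : k]` is odd; hence `m` is
odd and an element of square norm has even valuation (`exists_even_hasNormalizedValuation`).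

*Lower niceness.* In fact `M₁` is trivial (`isSquare_of_sqrtExtensionUnramified`). Let `A` be the
integral closure of `O` in `L`. If `L(√α)/L` is unramified, then `α = s² (1 - 4 c)` with `c ∈ A`
(`exists_eq_sq_mul_one_sub_four_mul`), and `1 - 4 c` is a square as soon as `c` is of the form
`z² + z` modulo the maximal ideal, by Hensel's lemma (`isSquare_one_sub_four_mul`). Elements of
this form make up a subgroup of index two of the residue field. Choose `c₀ ∈ O` outside this
subgroup of the residue field of `k`; then `1 - 4 c₀` is not a square in `k`, and, the degree being
odd, it does not become one in `L` because its norm is an odd power of it. Consequently, if `α` is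
not a square, then `α (1 - 4 c₀)` is one; as `N(α)` is a square, taking norms shows that an odd
power of `1 - 4 c₀` is a square, a contradiction.

That `A` is a complete discrete valuation ring is proved with the spectral norm on `L`.
-/

/-! ### The ring of integers of a finite extension of a complete field -/

section CompleteField

open IsLocalRing

variable {k : Type*} [NontriviallyNormedField k] [IsUltrametricDist k] [CompleteSpace k]
  {O : ValuationSubring k} {L : Type*} [Field L] [Algebra k L] [FiniteDimensional k L]
  [Algebra O L] [IsScalarTower O k L]

/-- The minimal polynomial of an element integral over `O` has coefficients in `O`, and the spectral
norm is at most one exactly when these coefficients have norm at most one. -/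
theorem isIntegral_iff_spectralNorm_le_one {k : Type*} [NontriviallyNormedField k]
    {O : ValuationSubring k} {L : Type*} [Field L] [Algebra k L] [FiniteDimensional k L]
    [Algebra O L] [IsScalarTower O k L] (hO : ∀ x, x ∈ O ↔ ‖x‖ ≤ 1) (x : L) :
    IsIntegral O x ↔ spectralNorm k L x ≤ 1 := by
  have hx : IsIntegral k x := Algebra.IsIntegral.isIntegral x
  rw [spectralNorm, spectralValue_le_one_iff (minpoly.monic hx)]
  constructor
  · intro h n
    rw [minpoly.isIntegrallyClosed_eq_field_fractions' k h, coeff_map]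
    exact (hO _).1 (Subtype.mem _)
  · intro h
    have hl : minpoly k x ∈ lifts (algebraMap O k) := by
      rw [lifts_iff_coeff_lifts]
      intro n
      exact ⟨⟨_, (hO _).2 (h n)⟩, rfl⟩
    obtain ⟨q, hq, -, hm⟩ := lifts_and_degree_eq_and_monic hl (minpoly.monic hx)
    refine ⟨q, hm, ?_⟩
    rw [← aeval_def, ← aeval_map_algebraMap k, hq, minpoly.aeval]

/-- The spectral norm on `L` is multiplicative because `k` is complete, and its closed unit ball is
the integral closure of `O`; so the non-units of the latter are the elements of norm `< 1`. -/
theorem isLocalRing_integralClosure (hO : ∀ x, x ∈ O ↔ ‖x‖ ≤ 1) :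
    IsLocalRing (integralClosure O L) := by
  let := spectralNorm.normedField k L
  have hA : ∀ x : L, x ∈ integralClosure O L ↔ ‖x‖ ≤ 1 :=
    fun x => isIntegral_iff_spectralNorm_le_one hO x
  have : IsUltrametricDist L := IsUltrametricDist.isUltrametricDist_of_isNonarchimedean_norm
    (isNonarchimedean_spectralNorm (K := k) (L := L))
  have hu : ∀ a : integralClosure O L, ‖(a : L)‖ = 1 → IsUnit a := by
    intro a ha
    have h0 : (a : L) ≠ 0 := by rw [← norm_ne_zero_iff, ha]; exact one_ne_zero
    refine IsUnit.of_mul_eq_one ⟨(a : L)⁻¹, (hA _).2 (by rw [norm_inv, ha, inv_one])⟩ ?_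
    ext
    simp [h0]
  refine IsLocalRing.of_isUnit_or_isUnit_one_sub_self fun a => ?_
  rcases ((hA _).1 a.2).eq_or_lt with h | h
  · exact .inl (hu a h)
  · refine .inr (hu _ ?_)
    have h1 : ‖(1 : L)‖ ≠ ‖-(a : L)‖ := by rw [norm_one, norm_neg]; exact h.ne'
    have := IsUltrametricDist.norm_add_eq_max_of_norm_ne_norm h1
    simpa [h.le, ← sub_eq_add_neg] using this

theorem isDiscreteValuationRing_integralClosure [CharZero k] [IsDiscreteValuationRing O]
    (hO : ∀ x, x ∈ O ↔ ‖x‖ ≤ 1) :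
    IsDiscreteValuationRing (integralClosure O L) := by
  have := isLocalRing_integralClosure (L := L) hO
  have : FaithfulSMul O L := by
    rw [faithfulSMul_iff_algebraMap_injective, IsScalarTower.algebraMap_eq O k L]
    exact (algebraMap k L).injective.comp (FaithfulSMul.algebraMap_injective O k)
  have hf : ¬ IsField (integralClosure O L) := fun h =>
    IsDiscreteValuationRing.not_isField O
      (isField_of_isIntegral_of_isField (FaithfulSMul.algebraMap_injective O _) h)
  have hd : IsDedekindDomain (integralClosure O L) := integralClosure.isDedekindDomain O k L
  exact ((IsDiscreteValuationRing.TFAE (integralClosure O L) hf).out 0 2).2 hd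

/-- `L` is complete for the spectral norm, and the `n`-th power of the maximal ideal is the ball of
radius `‖π‖ ^ n`. -/
theorem isAdicComplete_integralClosure [CharZero k] [IsDiscreteValuationRing O]
    [IsLocalRing (integralClosure O L)] (hO : ∀ x, x ∈ O ↔ ‖x‖ ≤ 1) :
    IsAdicComplete (maximalIdeal (integralClosure O L)) (integralClosure O L) := by
  have := isDiscreteValuationRing_integralClosure (L := L) hO
  let := spectralNorm.normedField k L
  have : CompleteSpace L := spectralNorm.completeSpace k L
  have hA : ∀ x : L, x ∈ integralClosure O L ↔ ‖x‖ ≤ 1 :=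
    fun x => isIntegral_iff_spectralNorm_le_one hO x
  obtain ⟨π, hπ⟩ := IsDiscreteValuationRing.exists_irreducible (integralClosure O L)
  have hπ0 : (π : L) ≠ 0 := by simpa using hπ.ne_zero
  have hπ1 : ‖(π : L)‖ < 1 := by
    refine ((hA _).1 π.2).lt_of_ne fun h => hπ.not_isUnit ?_
    refine IsUnit.of_mul_eq_one ⟨(π : L)⁻¹, (hA _).2 (by rw [norm_inv, h, inv_one])⟩ ?_
    ext
    simp [hπ0]
  have hm : ∀ (n : ℕ) (x : integralClosure O L),
      x ∈ maximalIdeal (integralClosure O L) ^ n ↔ ‖(x : L)‖ ≤ ‖(π : L)‖ ^ n := by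
    intro n x
    rw [hπ.maximalIdeal_eq, Ideal.span_singleton_pow, Ideal.mem_span_singleton]
    constructor
    · rintro ⟨y, rfl⟩
      simpa using mul_le_mul_of_nonneg_left ((hA _).1 y.2) (pow_nonneg (norm_nonneg (π : L)) n)
    · intro h
      refine ⟨⟨x / π ^ n, (hA _).2 ?_⟩, ?_⟩
      · rw [norm_div, norm_pow]
        exact div_le_one_of_le₀ h (by positivity)
      · ext
        simp [mul_div_cancel₀ _ (pow_ne_zero n hπ0)]
  have hz : IsHausdorff (maximalIdeal (integralClosure O L)) (integralClosure O L) := inferInstance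
  refine { hz with prec' := fun f hf => ?_ }
  simp only [smul_eq_mul, Ideal.mul_top, SModEq.sub_mem, hm] at hf ⊢
  have hc : CauchySeq fun n => (f n : L) :=
    cauchySeq_of_le_geometric ‖(π : L)‖ 1 hπ1 fun n => by
      simpa [dist_eq_norm] using hf n.le_succ
  obtain ⟨l, hl⟩ := cauchySeq_tendsto_of_complete hc
  have hl1 : ‖l‖ ≤ 1 := le_of_tendsto hl.norm (.of_forall fun n => (hA _).1 (f n).2)
  refine ⟨⟨l, (hA l).2 hl1⟩, fun n => ?_⟩
  refine le_of_tendsto (tendsto_const_nhds.sub hl).norm ?_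
  filter_upwards [Filter.eventually_ge_atTop n] with m hnm
  simpa using hf hnm

end CompleteField

/-! ### Unramified quadratic extensions -/

section QuadraticExtension

open IsLocalRing

variable {L : Type*} [Field L]

/-- A quadratic extension `N = L(√α)`, given as a splitting field of `X² - α`: there are `r` with
`r² = α` and an automorphism `σ` with `σ r = -r`, and `N = L + L r`. -/
theorem exists_root_and_conjugation {N : Type*} [Field N] [Algebra L N] {α : L}
    (h2 : (2 : L) ≠ 0) (hα : ¬ IsSquare α) [IsSplittingField L N (X ^ 2 - C α : L[X])] :
    ∃ (r : N) (σ : N ≃ₐ[L] N), r ^ 2 = algebraMap L N α ∧ σ r = -r ∧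
      ∀ x : N, ∃ p q : L, x = algebraMap L N p + algebraMap L N q * r := by
  have hα0 : α ≠ 0 := by rintro rfl; exact hα (IsSquare.zero)
  have hdeg : (X ^ 2 - C α : L[X]).degree = 2 := degree_X_pow_sub_C two_pos α
  have hsep : (X ^ 2 - C α : L[X]).Separable :=
    separable_X_pow_sub_C α (by exact_mod_cast h2) hα0
  have : IsGalois L N := IsGalois.of_separable_splitting_field hsep
  have : FiniteDimensional L N := IsSplittingField.finiteDimensional N (X ^ 2 - C α : L[X])
  have hspl := IsSplittingField.splits N (X ^ 2 - C α : L[X])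
  obtain ⟨r, hr⟩ := hspl.exists_eval_eq_zero (by rw [degree_map, hdeg]; decide)
  have hr2 : r ^ 2 = algebraMap L N α := by
    simpa [sub_eq_zero] using hr
  have hrL : r ∉ (⊥ : IntermediateField L N) := by
    rw [IntermediateField.mem_bot]
    rintro ⟨s, rfl⟩
    rw [← map_pow] at hr2
    exact hα ⟨s, by rw [← (algebraMap L N).injective hr2, sq]⟩
  rw [IsGalois.mem_bot_iff_fixed] at hrL
  push Not at hrL
  obtain ⟨σ, hσ⟩ := hrL
  refine ⟨r, σ, hr2, ?_, fun x => ?_⟩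
  · have : σ r ^ 2 = r ^ 2 := by rw [← map_pow, hr2, AlgEquiv.commutes]
    exact (sq_eq_sq_iff_eq_or_eq_neg.1 this).resolve_left hσ
  · have hx : x ∈ Algebra.adjoin L ((X ^ 2 - C α : L[X]).rootSet N) := by
      rw [IsSplittingField.adjoin_rootSet]; trivial
    induction hx using Algebra.adjoin_induction with
    | mem y hy =>
      rw [mem_rootSet] at hy
      have : y ^ 2 = r ^ 2 := by
        rw [hr2]; simpa [sub_eq_zero] using hy.2
      rcases sq_eq_sq_iff_eq_or_eq_neg.1 this with rfl | rfl
      · exact ⟨0, 1, by simp⟩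
      · exact ⟨0, -1, by simp⟩
    | algebraMap a => exact ⟨a, 0, by simp⟩
    | add y z _ _ hy hz =>
      obtain ⟨p, q, rfl⟩ := hy
      obtain ⟨p', q', rfl⟩ := hz
      exact ⟨p + p', q + q', by simp; ring⟩
    | mul y z _ _ hy hz =>
      obtain ⟨p, q, rfl⟩ := hy
      obtain ⟨p', q', rfl⟩ := hz
      refine ⟨p * p' + q * q' * α, p * q' + p' * q, ?_⟩
      simp only [map_add, map_mul, ← hr2]
      ring

/-- If `B` is formally unramified over `A` and `σ ≠ id` is an `A`-algebra endomorphism of `B`, then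
the differences `b - σ b` do not all lie in a proper ideal `P`: otherwise `σ` and `id` agree modulo
`P`, hence, `B` being formally unramified, modulo all powers of `P`, whose intersection is zero. -/
theorem exists_sub_notMem_of_formallyUnramified {A B : Type*} [CommRing A] [CommRing B]
    [IsDomain B] [IsNoetherianRing B] [Algebra A B] [Algebra.FormallyUnramified A B]
    {σ : B →ₐ[A] B} (hσ : σ ≠ AlgHom.id A B) {P : Ideal B} (hP : P ≠ ⊤) :
    ∃ b, b - σ b ∉ P := by
  by_contra! h
  exact hσ <| Algebra.FormallyUnramified.ext_of_iInf P (Ideal.iInf_pow_eq_bot_of_isDomain P hP)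
    fun b => (Ideal.Quotient.eq.2 (h b)).symm

/-- If `A` is local with `2` a non-unit and `L(√α)/L` is unramified at `A`, then up to squares
`α` is `1 - 4 c` with `c ∈ A`. Indeed some integral `b` has `b - σ b` a unit, so that the
discriminant `T² - 4 n` of the minimal polynomial `X² - T X + n` of `b` is a unit; it is `α` times
a square, and `T` is a unit as well. -/
theorem exists_eq_sq_mul_one_sub_four_mul {A N : Type*} [CommRing A] [IsDomain A] [IsLocalRing A]
    [IsNoetherianRing A] [IsIntegrallyClosed A] [Algebra A L] [IsFractionRing A L]
    [Field N] [Algebra L N] [Algebra A N] [IsScalarTower A L N] {α : L}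
    (h2 : (2 : L) ≠ 0) (h2m : (2 : A) ∈ maximalIdeal A)
    [IsSplittingField L N (X ^ 2 - C α : L[X])]
    [Algebra.FormallyUnramified A (integralClosure A N)] :
    ∃ (c : A) (s : L), α = s ^ 2 * (1 - 4 * algebraMap A L c) := by
  by_cases hα : IsSquare α
  · obtain ⟨s, rfl⟩ := hα
    exact ⟨0, s, by simp [sq]⟩
  obtain ⟨r, σ, hr, hσr, hspan⟩ := exists_root_and_conjugation (N := N) h2 hα
  have hα0 : α ≠ 0 := by rintro rfl; exact hα (IsSquare.zero)
  have hsep : (X ^ 2 - C α : L[X]).Separable :=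
    separable_X_pow_sub_C α (by exact_mod_cast h2) hα0
  have : IsGalois L N := IsGalois.of_separable_splitting_field hsep
  have : FiniteDimensional L N := IsSplittingField.finiteDimensional N (X ^ 2 - C α : L[X])
  have : IsNoetherianRing (integralClosure A N) :=
    IsIntegralClosure.isNoetherianRing A L N (integralClosure A N)
  have : IsFractionRing (integralClosure A N) N :=
    integralClosure.isFractionRing_of_finite_extension L N
  let τ : integralClosure A N →ₐ[A] integralClosure A N :=
    ((σ.restrictScalars A).mapIntegralClosure : _ →ₐ[A] _)
  have hτ : ∀ b, ((τ b : integralClosure A N) : N) = σ b := fun b => rfl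
  -- `σ` moves `r`, and `N` is the fraction field of the integral closure of `A`, on which `σ` is
  -- therefore not the identity
  have hτ1 : τ ≠ AlgHom.id A _ := by
    intro h
    have hfix : ∀ x : N, σ x = x := by
      intro x
      obtain ⟨a, b, hb, rfl⟩ := IsFractionRing.div_surjective (A := integralClosure A N) x
      have hb' : ∀ b : integralClosure A N, σ (algebraMap _ N b) = algebraMap _ N b := by
        intro b
        have := congrArg (fun x : integralClosure A N => (x : N)) (DFunLike.congr_fun h b)
        exact this
      rw [map_div₀, hb', hb']
    have h3 : (2 : N) * r = 0 := by
      linear_combination hσr - hfix r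
    have h4 : (2 : N) ≠ 0 := by
      rw [← map_ofNat (algebraMap L N) 2]
      exact (map_ne_zero (algebraMap L N)).2 h2
    have h5 : r = 0 := (mul_eq_zero.1 h3).resolve_left h4
    rw [h5] at hr
    apply hα0
    apply (algebraMap L N).injective
    rw [← hr]; simp
  obtain ⟨P, hP⟩ := Ideal.exists_maximal (integralClosure A N)
  obtain ⟨b, hb⟩ := exists_sub_notMem_of_formallyUnramified hτ1 hP.ne_top
  obtain ⟨p, q, hpq⟩ := hspan b
  have hσb : σ b = algebraMap L N p - algebraMap L N q * r := by
    rw [hpq]; simp [hσr]; ring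
  -- elements of `L` whose image in `N` is integral over `A` come from `A`
  have hint : ∀ (x : L) (y : integralClosure A N), algebraMap L N x = y →
      ∃ a : A, algebraMap A L a = x := by
    intro x y hxy
    apply IsIntegrallyClosed.isIntegral_iff.1
    have := y.2
    rw [← hxy] at this
    exact (isIntegral_algebraMap_iff (algebraMap L N).injective).1 this
  obtain ⟨T, hT⟩ := hint (2 * p) (b + τ b) (by
    rw [AddMemClass.coe_add, hτ, hσb, hpq, map_mul, map_ofNat]
    ring)
  obtain ⟨n, hn⟩ := hint (p ^ 2 - q ^ 2 * α) (b * τ b) (by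
    rw [MulMemClass.coe_mul, hτ, hσb, hpq, map_sub, map_mul, map_pow, map_pow, ← hr]
    ring)
  -- the discriminant lies in `A` but not in the maximal ideal, which `P` lies over
  have hD : algebraMap A (integralClosure A N) (T ^ 2 - 4 * n) = (b - τ b) ^ 2 := by
    ext
    have : algebraMap A N (T ^ 2 - 4 * n) = ((b : N) - σ b) ^ 2 := by
      rw [IsScalarTower.algebraMap_apply A L N, hσb, hpq]
      simp only [map_sub, map_mul, map_pow, hT, hn, map_ofNat, ← hr]
      ring
    exact this
  have hmax : P.comap (algebraMap A (integralClosure A N)) = maximalIdeal A :=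
    eq_maximalIdeal (Ideal.isMaximal_comap_of_isIntegral_of_isMaximal P)
  have hDu : IsUnit (T ^ 2 - 4 * n) := by
    by_contra h
    rw [← mem_nonunits_iff, ← mem_maximalIdeal, ← hmax, Ideal.mem_comap, hD] at h
    exact hb (hP.isPrime.mem_of_pow_mem _ h)
  have hTu : IsUnit T := by
    by_contra h
    rw [← mem_nonunits_iff, ← mem_maximalIdeal] at h
    refine (mem_maximalIdeal _).1 ?_ hDu
    have h4 : (4 : A) * n = 2 * (2 * n) := by ring
    rw [h4]
    exact Ideal.sub_mem _ (Ideal.pow_mem_of_mem _ h 2 two_pos) (Ideal.mul_mem_right _ _ h2m)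
  obtain ⟨U, hU⟩ := hTu.exists_right_inv
  have hDL : algebraMap A L (T ^ 2 - 4 * n) = 4 * q ^ 2 * α := by
    simp only [map_sub, map_mul, map_pow, hT, hn, map_ofNat]; ring
  have hq : q ≠ 0 := by
    rintro rfl
    have := (hDu.map (algebraMap A L)).ne_zero
    rw [hDL] at this
    simp at this
  refine ⟨n * U ^ 2, algebraMap A L T / (2 * q), ?_⟩
  have hUL : algebraMap A L T * algebraMap A L U = 1 := by rw [← map_mul, hU, map_one]
  have : α = (algebraMap A L T ^ 2 - 4 * algebraMap A L n) / (2 * q) ^ 2 := by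
    rw [eq_div_iff (by simp [h2, hq])]
    have := hDL
    simp only [map_sub, map_mul, map_pow, map_ofNat] at this
    linear_combination -this
  rw [this, div_pow, div_mul_eq_mul_div]
  congr 1
  rw [map_mul, map_pow]
  linear_combination 4 * algebraMap A L n * (algebraMap A L T * algebraMap A L U + 1) * hUL

end QuadraticExtension

/-! ### The Artin–Schreier map and unramified classes of square norm -/

section ArtinSchreier

open IsLocalRing

/-- Hensel's lemma for `X² + X + c`, whose derivative `2 X + 1` takes unit values. -/
theorem exists_sq_add_self_add_eq_zero {A : Type*} [CommRing A] [IsLocalRing A]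
    [IsAdicComplete (maximalIdeal A) A] (h2m : (2 : A) ∈ maximalIdeal A) {c z : A}
    (hz : z ^ 2 + z + c ∈ maximalIdeal A) : ∃ x : A, x ^ 2 + x + c = 0 := by
  have hdeg : (X + C c : A[X]).degree ≤ 1 := by
    compute_degree!
  obtain ⟨x, hx, -⟩ := HenselianRing.is_henselian (I := maximalIdeal A) (X ^ (1 + 1) + (X + C c))
    (monic_X_pow_add (hdeg.trans_lt (by norm_num))) z (by simpa [add_assoc] using hz) (by
      refine (IsUnit.map _ ?_)
      rw [← notMem_maximalIdeal]
      intro h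
      have h1 : (1 : A) ∈ maximalIdeal A := by
        convert Ideal.sub_mem _ h (Ideal.mul_mem_right z _ h2m) using 1
        simp
        ring
      exact (Ideal.ne_top_iff_one _).1 (maximalIdeal.isMaximal A).ne_top h1)
  exact ⟨x, by simpa [add_assoc] using hx⟩

/-- The Artin–Schreier map `x ↦ x² + x` of a field of characteristic two. -/
noncomputable def artinSchreierHom (l : Type*) [Field l] [CharP l 2] : l →+ l where
  toFun x := x ^ 2 + x
  map_zero' := by simp
  map_add' x y := by rw [CharTwo.add_sq]; ring

theorem mem_ker_artinSchreierHom {l : Type*} [Field l] [CharP l 2] {x : l} :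
    x ∈ (artinSchreierHom l).ker ↔ x = 0 ∨ x = 1 := by
  rw [AddMonoidHom.mem_ker]
  change x ^ 2 + x = 0 ↔ _
  have : x ^ 2 + x = x * (x - 1) := by rw [CharTwo.sub_eq_add]; ring
  rw [this, mul_eq_zero, sub_eq_zero]

theorem index_range_artinSchreierHom (l : Type*) [Field l] [CharP l 2] [Finite l] :
    (artinSchreierHom l).range.index = 2 := by
  have hk : Nat.card (artinSchreierHom l).ker = 2 := by
    have : ((artinSchreierHom l).ker : Set l) = {0, 1} := by
      ext x; exact mem_ker_artinSchreierHom
    rw [← SetLike.coe_sort_coe, this, Nat.card_coe_set_eq, Set.ncard_pair zero_ne_one]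
  have h1 := (artinSchreierHom l).range.card_mul_index
  have h2 := (artinSchreierHom l).ker.card_mul_index
  rw [AddSubgroup.index_ker, hk] at h2
  have h0 : 0 < Nat.card (artinSchreierHom l).range := Nat.card_pos
  nlinarith

end ArtinSchreier

section OddDegree

open IsLocalRing

theorem isSquare_of_isSquare_pow_odd {k : Type*} [Field k] {u : k} {d : ℕ} (hd : Odd d)
    (h : IsSquare (u ^ d)) : IsSquare u := by
  obtain ⟨m, rfl⟩ := hd
  by_cases hu : u = 0
  · rw [hu]; exact IsSquare.zero
  · have : u = u ^ (2 * m + 1) * ((u ^ m)⁻¹) ^ 2 := by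
      field_simp
      ring
    rw [this]
    exact h.mul (IsSquare.sq _)

variable {k : Type*} [NontriviallyNormedField k] [IsUltrametricDist k] [CompleteSpace k]
  {O : ValuationSubring k} {L : Type*} [Field L] [Algebra k L] [FiniteDimensional k L]
  [Algebra O L] [IsScalarTower O k L]

/-- `1 - 4 c` is the discriminant of `X² + X + c`. -/
theorem isSquare_one_sub_four_mul {A L : Type*} [CommRing A] [IsLocalRing A]
    [IsAdicComplete (maximalIdeal A) A] [Field L] [Algebra A L]
    (h2m : (2 : A) ∈ maximalIdeal A) {c z : A}
    (hz : z ^ 2 + z + c ∈ maximalIdeal A) : IsSquare (1 - 4 * algebraMap A L c) := by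
  obtain ⟨x, hx⟩ := exists_sq_add_self_add_eq_zero h2m hz
  refine ⟨2 * algebraMap A L x + 1, ?_⟩
  have := congrArg (algebraMap A L) hx
  simp only [map_add, map_pow, map_zero] at this
  linear_combination -4 * this

theorem exists_eq_sq_mul_of_isUnramifiedExtension {R : Type*} [CommRing R]
    {L : Type*} [Field L] [CharZero L] [Algebra R L] [IsLocalRing (integralClosure R L)]
    [IsNoetherianRing (integralClosure R L)] [IsFractionRing (integralClosure R L) L]
    [IsIntegrallyClosed (integralClosure R L)]
    (h2m : (2 : integralClosure R L) ∈ maximalIdeal (integralClosure R L)) (α : L)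
    {N : Type*} [Field N] [Algebra L N] [IsSplittingField L N (X ^ 2 - C α : L[X])]
    (hu : IsUnramifiedExtension R L N) :
    ∃ (c : integralClosure R L) (s : L), α = s ^ 2 * (1 - 4 * algebraMap _ L c) := by
  have hunr : Algebra.Unramified (integralClosure R L)
    (integralClosure (integralClosure R L) N) := hu
  have := hunr.formallyUnramified
  exact exists_eq_sq_mul_one_sub_four_mul (N := N) two_ne_zero h2m

/-- If `L(√α)/L` were a nontrivial unramified extension, `α` would be, up to squares, a non-square
`1 - 4 c₀` of `k`. The norm of `1 - 4 c₀` is an odd power of it and so not a square, which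
contradicts the assumption on the norm of `α`. -/
theorem isSquare_of_sqrtExtensionUnramified [CharZero k] [IsDiscreteValuationRing O]
    [Finite (ResidueField O)] (hO : ∀ x, x ∈ O ↔ ‖x‖ ≤ 1) (h2 : (2 : O) ∈ maximalIdeal O)
    (hodd : Odd (Module.finrank k L)) {α : L} (hα : α ≠ 0)
    (hN : IsSquare (Algebra.norm k α)) (hu : SqrtExtensionUnramified O α) : IsSquare α := by
  have : FaithfulSMul O L := by
    rw [faithfulSMul_iff_algebraMap_injective, IsScalarTower.algebraMap_eq O k L]
    exact (algebraMap k L).injective.comp (FaithfulSMul.algebraMap_injective O k)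
  have := isDiscreteValuationRing_integralClosure (L := L) hO
  have := isAdicComplete_integralClosure (L := L) hO
  have : CharZero L := charZero_of_injective_algebraMap (algebraMap k L).injective
  have : IsFractionRing (integralClosure O L) L :=
    integralClosure.isFractionRing_of_finite_extension k L
  have : Module.Finite O (integralClosure O L) := IsIntegralClosure.finite O k L _
  have h2m : (2 : integralClosure O L) ∈ maximalIdeal (integralClosure O L) := by
    rw [← map_ofNat (algebraMap O (integralClosure O L)) 2, mem_maximalIdeal, map_mem_nonunits_iff]
    exact h2
  have hl : CharP (ResidueField (integralClosure O L)) 2 :=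
    CharTwo.of_one_ne_zero_of_two_eq_zero one_ne_zero (by
      rw [← map_ofNat (residue (integralClosure O L)) 2, residue_eq_zero_iff]
      exact h2m)
  have hlO : CharP (ResidueField O) 2 :=
    CharTwo.of_one_ne_zero_of_two_eq_zero one_ne_zero (by
      rw [← map_ofNat (residue O) 2, residue_eq_zero_iff]
      exact h2)
  have : Finite (ResidueField (integralClosure O L)) :=
    ResidueField.finite_of_finite (R := O) inferInstance
  -- the Artin–Schreier map is not surjective on the residue field of `k`
  obtain ⟨c₀', hc₀'⟩ : ∃ c, c ∉ (artinSchreierHom (ResidueField O)).range := by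
    by_contra! h
    have h1 := index_range_artinSchreierHom (ResidueField O)
    rw [(AddSubgroup.eq_top_iff' _).2 h, AddSubgroup.index_top] at h1
    exact absurd h1 (by norm_num)
  obtain ⟨c₀, rfl⟩ := residue_surjective c₀'
  -- from a square root `u` one gets the root `(u - 1) / 2` of `X² + X + c₀`, which lies in `O`
  have hns : ¬ IsSquare (1 - 4 * algebraMap O k c₀) := by
    rintro ⟨u, hu⟩
    have hx : ((u - 1) / 2) ^ 2 + (u - 1) / 2 + algebraMap O k c₀ = 0 := by
      field_simp
      linear_combination -hu
    have hxi : IsIntegral O ((u - 1) / 2) := by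
      refine ⟨X ^ (1 + 1) + (X + C c₀), monic_X_pow_add ?_, by simpa [add_assoc] using hx⟩
      have hdeg : (X + C c₀ : O[X]).degree ≤ 1 := by
        compute_degree!
      exact hdeg.trans_lt (by norm_num)
    obtain ⟨x, hx'⟩ := IsIntegrallyClosed.isIntegral_iff.1 hxi
    have hx0 : x ^ 2 + x + c₀ = 0 := by
      apply FaithfulSMul.algebraMap_injective O k
      rw [map_add, map_add, map_pow, map_zero, hx', hx]
    refine hc₀' ⟨residue O x, ?_⟩
    change residue O x ^ 2 + residue O x = _
    rw [← CharTwo.add_eq_zero, ← map_pow, ← map_add, ← map_add, hx0, map_zero]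
  -- taking norms: `N(1 - 4 c₀)` is an odd power of `1 - 4 c₀`
  have hns' : ∀ β : L, IsSquare (Algebra.norm k β) → β ≠ 0 →
      ¬ IsSquare (β * algebraMap k L (1 - 4 * algebraMap O k c₀)) := by
    intro β hβ hβ0 h
    have h1 := h.map (Algebra.norm k)
    rw [map_mul, Algebra.norm_algebraMap] at h1
    have h3 := (h1.mul hβ.inv)
    rw [mul_comm, inv_mul_cancel_left₀ (by simpa [Algebra.norm_eq_zero_iff] using hβ0)] at h3
    exact hns (isSquare_of_isSquare_pow_odd hodd h3)
  have hcast : algebraMap k L (1 - 4 * algebraMap O k c₀) = 1 -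
      4 * algebraMap (integralClosure O L) L (algebraMap O (integralClosure O L) c₀) := by
    rw [← IsScalarTower.algebraMap_apply, IsScalarTower.algebraMap_apply O k L, map_sub, map_mul,
      map_one, map_ofNat]
  obtain ⟨c, s, hcs⟩ := exists_eq_sq_mul_of_isUnramifiedExtension h2m α hu
  have key : ∀ a : integralClosure O L,
      residue _ a ∈ (artinSchreierHom (ResidueField (integralClosure O L))).range →
      IsSquare (1 - 4 * algebraMap (integralClosure O L) L a) := by
    rintro a ⟨z', hz'⟩
    obtain ⟨z, rfl⟩ := residue_surjective z'
    refine isSquare_one_sub_four_mul (z := z) h2m ?_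
    rw [← residue_eq_zero_iff, map_add, map_add, map_pow]
    change residue _ z ^ 2 + residue _ z = _ at hz'
    rw [hz', CharTwo.add_self_eq_zero]
  by_cases hc : residue _ c ∈ (artinSchreierHom (ResidueField (integralClosure O L))).range
  · rw [hcs]
    exact (IsSquare.sq s).mul (key c hc)
  exfalso
  by_cases hc₀ : residue _ (algebraMap O (integralClosure O L) c₀) ∈
      (artinSchreierHom (ResidueField (integralClosure O L))).range
  · refine hns' 1 (by simp) one_ne_zero ?_
    rw [one_mul, hcast]
    exact key _ hc₀
  · refine hns' α hN hα ?_
    -- `(1 - 4 c) (1 - 4 c₀) = 1 - 4 c'` with `c' ≡ c + c₀` modulo `2`, and `c + c₀` lies in the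
    -- subgroup of index two since neither `c` nor `c₀` does
    have h4 : (1 - 4 * algebraMap (integralClosure O L) L c) * (1 - 4 *
        algebraMap (integralClosure O L) L (algebraMap O (integralClosure O L) c₀)) =
        1 - 4 * algebraMap (integralClosure O L) L (c + algebraMap O (integralClosure O L) c₀ -
          2 * (2 * (c * algebraMap O (integralClosure O L) c₀))) := by
      simp only [map_sub, map_add, map_mul, map_ofNat]
      ring
    rw [hcast, hcs, mul_assoc, h4]
    refine (IsSquare.sq s).mul (key _ ?_)
    rw [map_sub, (residue_eq_zero_iff _).2 (Ideal.mul_mem_right _ _ h2m), sub_zero, map_add,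
      AddSubgroup.add_mem_iff_of_index_two (index_range_artinSchreierHom _)]
    exact iff_of_false hc hc₀

end OddDegree

/-! ### Valuations of elements of square norm -/

section Valuation

open IsLocalRing

theorem exists_eq_units_mul_zpow {A L : Type*} [CommRing A] [IsDomain A]
    [IsDiscreteValuationRing A] [Field L] [Algebra A L] [IsFractionRing A L] {π : A}
    (hπ : Irreducible π) {x : L} (hx : x ≠ 0) :
    ∃ (u : Aˣ) (n : ℤ), x = algebraMap A L u * algebraMap A L π ^ n := by
  obtain ⟨a, b, hb, rfl⟩ := IsFractionRing.div_surjective (A := A) x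
  have hb0 : b ≠ 0 := nonZeroDivisors.ne_zero hb
  have ha0 : a ≠ 0 := by
    rintro rfl
    simp at hx
  have hπ0 : algebraMap A L π ≠ 0 := by
    simpa using hπ.ne_zero
  obtain ⟨n, u, rfl⟩ := IsDiscreteValuationRing.eq_unit_mul_pow_irreducible ha0 hπ
  obtain ⟨m, v, rfl⟩ := IsDiscreteValuationRing.eq_unit_mul_pow_irreducible hb0 hπ
  refine ⟨u * v⁻¹, n - m, ?_⟩
  have hv : algebraMap A L v ≠ 0 := (v.isUnit.map (algebraMap A L)).ne_zero
  have hv' : algebraMap A L v * algebraMap A L (v⁻¹ : Aˣ) = 1 := by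
    rw [← map_mul, Units.mul_inv, map_one]
  have hv'' : algebraMap A L (v⁻¹ : Aˣ) = (algebraMap A L v)⁻¹ := eq_inv_of_mul_eq_one_right hv'
  rw [zpow_sub₀ hπ0, Units.val_mul, map_mul, map_mul, map_mul, map_pow, map_pow, hv'',
    zpow_natCast, zpow_natCast]
  field_simp

variable {k : Type*} [NontriviallyNormedField k] [IsUltrametricDist k] [CompleteSpace k]
  {O : ValuationSubring k} {L : Type*} [Field L] [Algebra k L] [FiniteDimensional k L]
  [Algebra O L] [IsScalarTower O k L]

theorem norm_algebraNorm_eq_one {k : Type*} [NontriviallyNormedField k]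
    {O : ValuationSubring k} {L : Type*} [Field L] [Algebra k L] [FiniteDimensional k L]
    [Algebra O L] [IsScalarTower O k L] (hO : ∀ x, x ∈ O ↔ ‖x‖ ≤ 1)
    (u : (integralClosure O L)ˣ) :
    ‖Algebra.norm k ((u : integralClosure O L) : L)‖ = 1 := by
  have h : ∀ a : integralClosure O L, ‖Algebra.norm k (a : L)‖ ≤ 1 := by
    intro a
    obtain ⟨y, hy⟩ := IsIntegrallyClosed.isIntegral_iff.1 (Algebra.isIntegral_norm k a.2)
    rw [← hO, ← hy]
    exact y.2
  refine le_antisymm (h _) ?_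
  have h1 : Algebra.norm k ((u : integralClosure O L) : L) *
      Algebra.norm k (((u⁻¹ : (integralClosure O L)ˣ) : integralClosure O L) : L) = 1 := by
    rw [← map_mul, ← MulMemClass.coe_mul, Units.mul_inv, OneMemClass.coe_one, map_one]
  have h2 := congrArg norm h1
  rw [norm_mul, norm_one] at h2
  rw [← h2]
  exact mul_le_of_le_one_right (norm_nonneg _) (h _)

theorem algebraNorm_inv {k L : Type*} [Field k] [Field L] [Algebra k L] [FiniteDimensional k L]
    (x : L) : Algebra.norm k x⁻¹ = (Algebra.norm k x)⁻¹ := by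
  by_cases hx : x = 0
  · simp [hx]
  · exact eq_inv_of_mul_eq_one_left (by rw [← map_mul, inv_mul_cancel₀ hx, map_one])

/-- Let `e` be the valuation in `L` of a uniformizer of `k`, and `f` the valuation of the norm of a
uniformizer of `L`. Taking norms gives `e f = [L : k]`; if this is odd then so is `f`,
and an element of square norm has even valuation. -/
theorem exists_even_hasNormalizedValuation [CharZero k] [IsDiscreteValuationRing O]
    (hO : ∀ x, x ∈ O ↔ ‖x‖ ≤ 1) (hodd : Odd (Module.finrank k L)) {β : L} (hβ : β ≠ 0)
    (hN : IsSquare (Algebra.norm k β)) : ∃ n : ℤ, Even n ∧ HasNormalizedValuation O β n := by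
  have := isDiscreteValuationRing_integralClosure (L := L) hO
  have : IsFractionRing (integralClosure O L) L :=
    integralClosure.isFractionRing_of_finite_extension k L
  obtain ⟨ϖ, hϖ⟩ := IsDiscreteValuationRing.exists_irreducible O
  obtain ⟨π, hπ⟩ := IsDiscreteValuationRing.exists_irreducible (integralClosure O L)
  have hϖ0 : (ϖ : k) ≠ 0 := by simpa using hϖ.ne_zero
  have hπ0 : (π : L) ≠ 0 := by simpa using hπ.ne_zero
  have hunit : ∀ u : Oˣ, ‖((u : O) : k)‖ = 1 := by
    intro u
    refine le_antisymm ((hO _).1 (u : O).2) ?_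
    have h1 : ((u : O) : k) * (((u⁻¹ : Oˣ) : O) : k) = 1 := by
      rw [← MulMemClass.coe_mul, Units.mul_inv, OneMemClass.coe_one]
    have h2 := congrArg norm h1
    rw [norm_mul, norm_one] at h2
    rw [← h2]
    exact mul_le_of_le_one_right (norm_nonneg _) ((hO _).1 (Subtype.mem _))
  have hϖ1 : ‖(ϖ : k)‖ < 1 := by
    refine ((hO _).1 ϖ.2).lt_of_ne fun h => hϖ.not_isUnit ?_
    refine IsUnit.of_mul_eq_one ⟨(ϖ : k)⁻¹, (hO _).2 (by rw [norm_inv, h, inv_one])⟩ ?_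
    ext
    simp [hϖ0]
  have hk : ∀ x : k, x ≠ 0 → ∃ m : ℤ, ‖x‖ = ‖(ϖ : k)‖ ^ m := by
    intro x hx
    obtain ⟨u, m, rfl⟩ := exists_eq_units_mul_zpow hϖ hx
    refine ⟨m, ?_⟩
    rw [norm_mul, norm_zpow]
    exact (congrArg (· * _) (hunit u)).trans (one_mul _)
  have hinj : ∀ a b : ℤ, ‖(ϖ : k)‖ ^ a = ‖(ϖ : k)‖ ^ b → a = b := fun a b h =>
    zpow_right_injective₀ (norm_pos_iff.2 hϖ0) hϖ1.ne h
  have hNπ0 : Algebra.norm k (π : L) ≠ 0 := by simpa [Algebra.norm_eq_zero_iff] using hπ0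
  obtain ⟨f, hf⟩ := hk _ hNπ0
  -- the norm multiplies valuations by `f`
  have hL : ∀ x : L, x ≠ 0 → ∃ (u : (integralClosure O L)ˣ) (n : ℤ),
      x = ((u : integralClosure O L) : L) * (π : L) ^ n ∧
      ‖Algebra.norm k x‖ = ‖(ϖ : k)‖ ^ (f * n) := by
    intro x hx
    obtain ⟨u, n, h⟩ := exists_eq_units_mul_zpow hπ hx
    refine ⟨u, n, h, ?_⟩
    rw [h, map_mul, map_zpow' _ algebraNorm_inv, norm_mul, norm_zpow, zpow_mul, ← hf]
    exact (congrArg (· * _) (norm_algebraNorm_eq_one hO u)).trans (one_mul _)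
  obtain ⟨-, e, -, he⟩ := hL (algebraMap k L ϖ) (by simpa using hϖ0)
  rw [Algebra.norm_algebraMap, norm_pow, ← zpow_natCast] at he
  have hfe := hinj _ _ he
  have hfodd : Odd f := by
    have : Odd ((Module.finrank k L : ℕ) : ℤ) := (Int.odd_coe_nat _).2 hodd
    rw [hfe, Int.odd_mul] at this
    exact this.1
  obtain ⟨u, n, h, hn⟩ := hL β hβ
  refine ⟨n, ?_, π, u, hπ, h⟩
  obtain ⟨y, hy⟩ := hN
  have hy0 : y ≠ 0 := by
    rintro rfl
    rw [mul_zero, Algebra.norm_eq_zero_iff] at hy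
    exact hβ hy
  obtain ⟨m, hm⟩ := hk y hy0
  rw [hy, norm_mul, hm, ← zpow_add₀ (norm_ne_zero_iff.2 hϖ0)] at hn
  have h2 : Even (f * n) := ⟨m, (hinj _ _ hn).symm⟩
  rw [Int.even_mul] at h2
  exact h2.resolve_left (Int.not_even_iff_odd.2 hfodd)

end Valuation

/-! ### The completion of a number field at a finite prime -/

section Completion

open IsLocalRing HeightOneSpectrum

open scoped Valued

variable {K : Type*} [Field K] [NumberField K] (v : HeightOneSpectrum (𝓞 K))

theorem mem_maximalIdeal_adicCompletionIntegers_iff {x : v.adicCompletionIntegers K} :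
    x ∈ maximalIdeal (v.adicCompletionIntegers K) ↔ Valued.v (x : v.adicCompletion K) < 1 := by
  rw [mem_maximalIdeal, mem_nonunits_iff, adicCompletionIntegers.isUnit_iff_valued_eq_one]
  exact (lt_iff_le_and_ne.trans (and_iff_right x.2)).symm

theorem algebraMap_mem_maximalIdeal_adicCompletionIntegers {a : 𝓞 K} (ha : a ∈ v.asIdeal) :
    algebraMap (𝓞 K) (v.adicCompletionIntegers K) a ∈
      maximalIdeal (v.adicCompletionIntegers K) := by
  rw [mem_maximalIdeal_adicCompletionIntegers_iff]
  exact (valuedAdicCompletion_eq_valuation (K := K) v a).trans_lt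
    ((valuation_lt_one_iff_mem v a).2 ha)

/-- The residue field of `K_v` is a quotient of `𝓞 K / v`, because `K` is dense in `K_v` and
`v`-integral elements of `K` are congruent to elements of `𝓞 K`. -/
theorem finite_residueField_adicCompletionIntegers :
    Finite (ResidueField (v.adicCompletionIntegers K)) := by
  have : Finite (𝓞 K ⧸ v.asIdeal) := v.asIdeal.finiteQuotientOfFreeOfNeBot v.ne_bot
  let g : 𝓞 K ⧸ v.asIdeal →+* ResidueField (v.adicCompletionIntegers K) :=
    Ideal.Quotient.lift v.asIdeal ((residue _).comp (algebraMap _ _)) fun a ha =>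
      (residue_eq_zero_iff _).2 (algebraMap_mem_maximalIdeal_adicCompletionIntegers v ha)
  refine Finite.of_surjective g fun y => ?_
  obtain ⟨y, rfl⟩ := residue_surjective y
  obtain ⟨z, hz⟩ := (denseRange_algebraMap K v).exists_dist_lt
    (y : v.adicCompletion K) one_pos
  rw [dist_eq_norm, Valued.toNormedField.norm_lt_one_iff] at hz
  have hz1 : v.valuation K z ≤ 1 := by
    rw [← valuedAdicCompletion_eq_valuation' v z]
    have : algebraMap K (v.adicCompletion K) z =
      (y : v.adicCompletion K) - (y - algebraMap K (v.adicCompletion K) z) := by ring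
    change Valued.v (algebraMap K (v.adicCompletion K) z) ≤ 1
    rw [this]
    exact (Valuation.map_sub _ _ _).trans (max_le y.2 hz.le)
  obtain ⟨a, ha⟩ := exists_valuation_sub_lt_of_integer v hz1 1
  refine ⟨Ideal.Quotient.mk _ a, ?_⟩
  change residue _ (algebraMap (𝓞 K) (v.adicCompletionIntegers K) a) = residue _ y
  rw [← sub_eq_zero, ← map_sub, residue_eq_zero_iff, mem_maximalIdeal_adicCompletionIntegers_iff]
  have h3 : ((algebraMap (𝓞 K) (v.adicCompletionIntegers K) a - y : v.adicCompletionIntegers K) :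
      v.adicCompletion K) = algebraMap K (v.adicCompletion K) (algebraMap (𝓞 K) K a - z) -
        (y - algebraMap K (v.adicCompletion K) z) := by
    rw [map_sub]
    change algebraMap K (v.adicCompletion K) (algebraMap (𝓞 K) K a) - (y : v.adicCompletion K) = _
    ring
  rw [h3]
  refine (Valuation.map_sub _ _ _).trans_lt (max_lt ?_ hz)
  exact (valuedAdicCompletion_eq_valuation' v _).trans_lt ha

end Completion

/-! ### The cubic algebra of a curve without rational two-torsion -/

section Irreducible

/-- A root of `f` in `k` is the abscissa of a point of order two. -/
theorem eval_ne_zero_of_card_twoTorsion {k : Type*} [Field k] {f : k[X]} (hf : f.Monic)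
    (hd : f.natDegree = 3) [(cubicCurve f).IsElliptic] (h : Nat.card (twoTorsion f) = 1) (x : k) :
    f.eval x ≠ 0 := by
  classical
  intro hx
  have h3 : f.coeff 3 = 1 := by rw [← hd]; exact hf
  have heq : (cubicCurve f).toAffine.Equation x 0 := by
    rw [WeierstrassCurve.Affine.equation_iff]
    rw [Polynomial.eval_eq_sum_range, hd] at hx
    simp only [Finset.sum_range_succ, Finset.sum_range_zero, h3] at hx
    simp only [cubicCurve]
    linear_combination -hx
  have hns : (cubicCurve f).toAffine.Nonsingular x 0 :=
    WeierstrassCurve.Affine.equation_iff_nonsingular.1 heq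
  have hP : WeierstrassCurve.Affine.Point.some x 0 hns ∈ twoTorsion f := by
    rw [AddMonoidHom.mem_ker]
    rw [zsmulAddGroupHom_apply, two_zsmul]
    convert WeierstrassCurve.Affine.Point.add_self_of_Y_eq (h₁ := hns) _
    simp [WeierstrassCurve.Affine.negY, cubicCurve]
  have : Subsingleton (twoTorsion f) := (Nat.card_eq_one_iff_unique.1 h).1
  have h0 := congrArg Subtype.val (Subsingleton.elim (⟨_, hP⟩ : twoTorsion f) 0)
  exact WeierstrassCurve.Affine.Point.some_ne_zero hns h0

theorem algebraNorm_mk_C_sub_X {k : Type*} [Field k] {f : k[X]} (hf : f.Monic) (x : k) :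
    Algebra.norm k (AdjoinRoot.mk f (C x - X)) = f.eval x := by
  have h := charpoly_leftMulMatrix (AdjoinRoot.powerBasis hf.ne_zero)
  rw [AdjoinRoot.powerBasis_gen, AdjoinRoot.minpoly_root hf.ne_zero, hf.leadingCoeff, inv_one,
    map_one, mul_one] at h
  conv_rhs => rw [← h]
  rw [Matrix.eval_charpoly, Algebra.norm_eq_matrix_det (AdjoinRoot.powerBasis hf.ne_zero).basis,
    map_sub, map_sub, AdjoinRoot.mk_X, AdjoinRoot.mk_C, ← AdjoinRoot.algebraMap_eq,
    AlgHom.commutes, Matrix.algebraMap_eq_diagonal, Matrix.scalar_apply]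
  rfl

end Irreducible

section Nice

/-- If `f` is irreducible, `k[x]/(f)` is its own only field factor. -/
noncomputable def factorEquiv {k : Type*} [Field k] {f : k[X]} (hirr : Irreducible f)
    (w : MaximalSpectrum (CubicAlgebra f)) :
    CubicAlgebra f ≃ₐ[k] FactorField w :=
  AlgEquiv.ofBijective (Ideal.Quotient.mkₐ k w.asIdeal)
    ⟨by
      have := Fact.mk hirr
      exact (factorMap w).injective, Ideal.Quotient.mk_surjective⟩

open IsLocalRing

theorem isNice_of_irreducible {k : Type*} [NontriviallyNormedField k] [IsUltrametricDist k]
    [CompleteSpace k] {f : k[X]} {O : ValuationSubring k} [CharZero k] [IsDiscreteValuationRing O]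
    [Finite (ResidueField O)] (hO : ∀ x, x ∈ O ↔ ‖x‖ ≤ 1) (h2 : (2 : O) ∈ maximalIdeal O)
    (hf : f.Monic) (hd : f.natDegree = 3) (hirr : Irreducible f) : IsNice O f hf hd := by
  have := Fact.mk hirr
  have hfin : Module.finrank k (CubicAlgebra f) = 3 := by
    rw [(AdjoinRoot.powerBasis hf.ne_zero).finrank, AdjoinRoot.powerBasis_dim, hd]
  have : FiniteDimensional k (CubicAlgebra f) := .of_finrank_pos (by rw [hfin]; norm_num)
  have hodd : ∀ w : MaximalSpectrum (CubicAlgebra f), Odd (Module.finrank k (FactorField w)) := by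
    intro w
    rw [← (factorEquiv hirr w).toLinearEquiv.finrank_eq, hfin]
    decide
  have hfd : ∀ w : MaximalSpectrum (CubicAlgebra f), FiniteDimensional k (FactorField w) :=
    fun w => (factorEquiv hirr w).toLinearEquiv.finiteDimensional
  have hnorm : ∀ (w : MaximalSpectrum (CubicAlgebra f)) (x : CubicAlgebra f),
      Algebra.norm k (factorMap w x) = Algebra.norm k x :=
    fun w x => Algebra.norm_eq_of_algEquiv (factorEquiv hirr w) x
  have hne : ∀ (w : MaximalSpectrum (CubicAlgebra f)) (x : (CubicAlgebra f)ˣ),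
      factorMap w (x : CubicAlgebra f) ≠ 0 :=
    fun w x => (x.isUnit.map (factorMap w)).ne_zero
  constructor
  · -- every class in `M₁` is trivial, hence the image of the point at infinity
    rintro _ ⟨α, rfl, hN, hu⟩
    refine ⟨.zero, ?_⟩
    obtain ⟨w⟩ : Nonempty (MaximalSpectrum (CubicAlgebra f)) := inferInstance
    have hfdw := hfd w
    rw [← hnorm w] at hN
    obtain ⟨s, hs⟩ := isSquare_of_sqrtExtensionUnramified hO h2 (hodd w) (hne w α) hN (hu w)
    obtain ⟨t, rfl⟩ := (factorEquiv hirr w).surjective s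
    have ht : (α : CubicAlgebra f) = t * t := by
      apply (factorEquiv hirr w).injective
      rw [map_mul]
      exact hs
    have htu : IsUnit t := isUnit_of_mul_isUnit_left (ht ▸ α.isUnit)
    refine Eq.symm ((QuotientGroup.eq_one_iff α).2 ⟨htu.unit, ?_⟩)
    ext
    simp [ht, sq]
  · rintro _ ⟨P, rfl⟩
    suffices h : ∃ α : (CubicAlgebra f)ˣ, kummerMap f hf hd P = sqClass α ∧
        IsSquare (Algebra.norm k (α : CubicAlgebra f)) by
      obtain ⟨α, h1, h2⟩ := h
      refine ⟨α, h1, h2, fun w => ?_⟩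
      have hfdw := hfd w
      rw [← hnorm w] at h2
      exact exists_even_hasNormalizedValuation hO (hodd w) (hne w α) h2
    match P with
    | .zero => exact ⟨1, rfl, by simp⟩
    | .some x y h =>
      refine ⟨(isUnit_kummerPoly hf hd h).unit, rfl, ?_⟩
      have hev := cubicCurve_equation hf hd h.1
      have hy : y ≠ 0 := by
        rintro rfl
        have hx : f.IsRoot x := by rw [IsRoot, hev, sq, mul_zero]
        have := degree_eq_one_of_irreducible_of_root hirr hx
        rw [degree_eq_natDegree hf.ne_zero, hd] at this
        exact absurd this (by decide)
      rw [IsUnit.unit_spec, kummerPoly, if_neg hy, algebraNorm_mk_C_sub_X hf, hev]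
      exact IsSquare.sq y

end Nice

theorem mainTheorem6 {K : Type*} [Field K] [NumberField K]
    (F : (𝓞 K)[X]) (hF : F.Monic) (hd : F.natDegree = 3)
    (hE : (cubicCurve (F.map (algebraMap (𝓞 K) K))).IsElliptic)
    (v : HeightOneSpectrum (𝓞 K)) (hv : IsEvenPrime v)
    (htors : Nat.card (twoTorsion (localPoly F v)) = 1) :
    IsField (CubicAlgebra (localPoly F v)) ∧
      Module.finrank (v.adicCompletion K) (CubicAlgebra (localPoly F v)) = 3 ∧
      IsNiceAt F hF hd v := by
  have hmon : (localPoly F v).Monic := hF.map _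
  have hdeg : (localPoly F v).natDegree = 3 := (hF.natDegree_map _).trans hd
  have hell : (cubicCurve (localPoly F v)).IsElliptic := by
    have h : localPoly F v = (F.map (algebraMap (𝓞 K) K)).map
        (algebraMap K (v.adicCompletion K)) := by
      rw [Polynomial.map_map, ← IsScalarTower.algebraMap_eq]
    rw [h, ← cubicCurve_map]
    infer_instance
  have hroot := eval_ne_zero_of_card_twoTorsion hmon hdeg htors
  have hirr : Irreducible (localPoly F v) := by
    rw [hmon.irreducible_iff_roots_eq_zero_of_degree_le_three (by omega) (by omega)]
    refine Multiset.eq_zero_of_forall_notMem fun x hx => hroot x (isRoot_of_mem_roots hx)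
  have := Fact.mk hirr
  refine ⟨Field.toIsField _, ?_, ?_⟩
  · rw [(AdjoinRoot.powerBasis hmon.ne_zero).finrank, AdjoinRoot.powerBasis_dim, hdeg]
  · have : CharZero (v.adicCompletion K) :=
      charZero_of_injective_algebraMap (algebraMap K (v.adicCompletion K)).injective
    let := Valued.toNontriviallyNormedField (L := v.adicCompletion K)
      (Γ₀ := WithZero (Multiplicative ℤ))
    have := finite_residueField_adicCompletionIntegers v
    refine isNice_of_irreducible (O := v.adicCompletionIntegers K) (fun x => ?_) ?_ hmon hdeg hirr
    · rw [Valued.toNormedField.norm_le_one_iff]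
      rfl
    · have := algebraMap_mem_maximalIdeal_adicCompletionIntegers v hv
      rwa [map_ofNat] at this
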